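/- Let $n\ge 1$, let $0<s<1$, and let $B_1$ be the open unit ball of $\mathbb{R}^n$. Write $\delta(x)=\operatorname{dist}(x,\mathbb{R}^n\setminus B_1)$, and for $r\in\mathbb{R}$, $1\le p\le\infty$ let $$L^p_r(B_1)=\{f\in L^1_{\mathrm{loc}}(B_1):\ \|f\|_{L^p_r(B_1)}:=\|\delta^r f\|_{L^p(B_1)}<\infty\}.$$ Let $$G(x,y)=\frac{\kappa(n,s)}{|x-y|^{n-2s}}\int_0^{\rho(x,y)}\frac{t^{s-1}}{(1+t)^{n/2}}\,dt,\qquad \rho(x,y)=\frac{(1-|x|^2)(1-|y|^2)}{|x-y|^2},\qquad x,y\in B_1,$$ with $\kappa(n,s)=\dfrac{\Gamma(n/2)}{2^{2s}\pi^{n/2}\Gamma(s)^2}$, be the Green function of $(-\Delta)^s$ in $B_1$, and let $G*f(x)=\int_{B_1}f(y)G(x,y)\,dy$ for $x\in B_1$ and $G*f(x)=0$ for $x\notin B_1$. Let $-s\le r\le s$, $1\le p<\infty$ and $f\in L^p_r(B_1)$. In each of the following three cases the integral defining $u=G*f$ converges absolutely for almost every $x\in B_1$, and: 1. If $p=1$,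 then for every $q$ with $1\le q<\frac{n}{n-2s}$ (every $1\le q<\infty$ if $n\le 2s$), $u\in L^q_r(B_1)$ and $\|u\|_{L^q_r(B_1)}\le C\|f\|_{L^1_r(B_1)}$, where $C>0$ depends only on $n,s,q$. 2. If $1<p<\frac{n}{2s}$, then $u\in L^{\frac{np}{n-2sp}}_r(B_1)$ and $\|u\|_{L^{\frac{np}{n-2sp}}_r(B_1)}\le C\|f\|_{L^p_r(B_1)}$, where $C>0$ depends only on $n,s,p$. 3. If $p>\frac{n}{2s}$, then $u\in L^\infty_r(B_1)$ and $\|u\|_{L^\infty_r(B_1)}\le C\|f\|_{L^p_r(B_1)}$, where $C>0$ depends only on $n,s,p$. -/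

import Mathlib

open MeasureTheory

noncomputable section

namespace FracLap

/-- The distance `δ` of a point of `ℝⁿ` to the complement of `Ω`. -/
def bdryDist {n : ℕ} (Ω : Set (EuclideanSpace ℝ (Fin n))) (x : EuclideanSpace ℝ (Fin n)) : ℝ :=
  Metric.infDist x Ωᶜ

/-- The weighted norm `‖f‖_{L^p_r(Ω)} = ‖δ^r f‖_{L^p(Ω)}`, with values in `[0, ∞]`. -/
def weightedNorm {n : ℕ} (Ω : Set (EuclideanSpace ℝ (Fin n))) (r : ℝ) (p : ENNReal)
    (f : EuclideanSpace ℝ (Fin n) → ℝ) : ENNReal :=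
  eLpNorm (fun x => bdryDist Ω x ^ r * f x) p (volume.restrict Ω)

/-- Membership in the weighted space `L^p_r(Ω)`: the functions in `L^1_loc(Ω)` whose weighted norm
is finite. -/
def MemWeightedLp {n : ℕ} (Ω : Set (EuclideanSpace ℝ (Fin n))) (r : ℝ) (p : ENNReal)
    (f : EuclideanSpace ℝ (Fin n) → ℝ) : Prop :=
  LocallyIntegrableOn f Ω volume ∧ weightedNorm Ω r p f < ⊤

/-- The open unit ball of `ℝⁿ` for the Euclidean norm. -/
def unitBall (n : ℕ) : Set (EuclideanSpace ℝ (Fin n)) := Metric.ball 0 1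

/-- The normalizing constant `κ(n,s) = Γ(n/2) / (2^{2s} π^{n/2} Γ(s)²)` of the Green function of
the fractional Laplacian `(-Δ)^s` in the unit ball. -/
def kappa (n : ℕ) (s : ℝ) : ℝ :=
  Real.Gamma ((n : ℝ) / 2) /
    ((2 : ℝ) ^ (2 * s) * Real.pi ^ ((n : ℝ) / 2) * Real.Gamma s ^ (2 : ℕ))

/-- `ρ(x,y) = (1 - |x|²)(1 - |y|²) / |x - y|²`. -/
def rho {n : ℕ} (x y : EuclideanSpace ℝ (Fin n)) : ℝ :=
  (1 - ‖x‖ ^ 2) * (1 - ‖y‖ ^ 2) / ‖x - y‖ ^ 2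

/-- The Green function `G(x,y)` of `(-Δ)^s` in the unit ball, for `x ≠ y` in the ball. -/
def green {n : ℕ} (s : ℝ) (x y : EuclideanSpace ℝ (Fin n)) : ℝ :=
  kappa n s / ‖x - y‖ ^ ((n : ℝ) - 2 * s) *
    ∫ t in (0 : ℝ)..(rho x y), t ^ (s - 1) / (1 + t) ^ ((n : ℝ) / 2)

open scoped Classical in
/-- The Green potential `G * f`: the integral of `G(x, ·) f` over the unit ball for `x` in the
unit ball, and `0` elsewhere. -/
def greenPotential {n : ℕ} (s : ℝ) (f : EuclideanSpace ℝ (Fin n) → ℝ)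
    (x : EuclideanSpace ℝ (Fin n)) : ℝ :=
  if x ∈ unitBall n then ∫ y in unitBall n, f y * green s x y else 0

/-- The integral that defines `G * f` converges absolutely at almost every point of the ball. -/
def GreenPotentialDefined {n : ℕ} (s : ℝ) (f : EuclideanSpace ℝ (Fin n) → ℝ) : Prop :=
  ∀ᵐ x ∂(volume.restrict (unitBall n)),
    IntegrableOn (fun y => f y * green s x y) (unitBall n) volume

end FracLap

end

/-! Conjugating with the weight reduces everything to unweighted Riesz potentials: for `-s ≤ r ≤ s`,
`δ(x)^r G(x,y) δ(y)^(-r) ≤ C |x-y|^(-a)` with `C` independent of `r` (`exists_weighted_green_le`).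
Here `a = n - 2s` if `2s < n`, and any `a` in `[0, n]` above `n - 2s` is also allowed.

Two regimes give the kernel bound. If both boundary distances are at most `2|x-y|`, then `G ≲ δ(x)^s
δ(y)^s |x-y|^(-n)`, and the remaining factor `δ(x)^(s+r) δ(y)^(s-r)` is at most `(2|x-y|)^(2s)`,
since `|r| ≤ s` makes both exponents nonnegative. Otherwise, `δ` being 1-Lipschitz, the two
distances agree up to a factor 2, the weights cost a bounded factor, and the plain bound `G ≲
|x-y|^(-a)` suffices.

It remains to bound the Riesz potential of `|δ^r f|` on the ball: by Jensen and Tonelli for `p = 1`,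
by Hardy–Littlewood–Sobolev (`exists_eLpNorm_riesz_le`) for `1 < p < n/(2s)`, and by Hölder for `p >
n/(2s)`. `exists_weighted_greenPotential_le` turns such a bound into absolute convergence,
membership and the norm estimate together. -/

namespace FracLap

open Set Metric Module
open scoped ENNReal NNReal

/-! ### Radial integrals of powers of the norm -/

section Radial

variable {E : Type*} [NormedAddCommGroup E] [NormedSpace ℝ E] [FiniteDimensional ℝ E]
  [MeasurableSpace E] [BorelSpace E] [Nontrivial E] (μ : Measure E) [μ.IsAddHaarMeasure]

/-- Polar coordinates. A general set of radii `S` serves both balls and their complements. -/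
theorem setLIntegral_rpow_norm {S : Set ℝ} (hS : MeasurableSet S) {l : ℝ}
    (hint : IntegrableOn (fun y : ℝ => y ^ ((finrank ℝ E : ℝ) - 1 - l)) (Ioi 0 ∩ S)) :
    ∫⁻ z in (fun z : E => ‖z‖) ⁻¹' S, ENNReal.ofReal (‖z‖ ^ (-l)) ∂μ =
      ENNReal.ofReal (finrank ℝ E * (μ.real (ball 0 1) *
        ∫ y in Ioi (0 : ℝ) ∩ S, y ^ ((finrank ℝ E : ℝ) - 1 - l))) := by
  set f : ℝ → ℝ := S.indicator fun y => y ^ (-l)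
  have hrw : ∀ y ∈ Ioi (0 : ℝ), S.indicator (fun y => y ^ ((finrank ℝ E : ℝ) - 1 - l)) y =
      y ^ (finrank ℝ E - 1) • f y := by
    intro y hy
    have hpow : y ^ (finrank ℝ E - 1) * y ^ (-l) = y ^ ((finrank ℝ E : ℝ) - 1 - l) := by
      rw [← Real.rpow_natCast, ← Real.rpow_add hy, Nat.cast_sub (finrank_pos (R := ℝ) (M := E))]
      simp [sub_eq_add_neg]
    by_cases h : y ∈ S
    · simp [f, indicator_of_mem h, hpow]
    · simp [f, indicator_of_notMem h]
  have hf : IntegrableOn (fun y : ℝ => y ^ (finrank ℝ E - 1) • f y) (Ioi 0) := by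
    refine IntegrableOn.congr_fun ?_ hrw measurableSet_Ioi
    rw [IntegrableOn, integrable_indicator_iff hS, IntegrableOn, Measure.restrict_restrict hS,
      inter_comm]
    exact hint
  have hintE : Integrable (fun x : E => f ‖x‖) μ := (integrable_fun_norm_addHaar μ).2 hf
  have hpos : 0 ≤ᵐ[μ] fun x : E => f ‖x‖ := by
    refine Filter.Eventually.of_forall fun x => ?_
    by_cases h : ‖x‖ ∈ S
    · simp only [f, indicator_of_mem h, Pi.zero_apply]
      positivity
    · simp [f, indicator_of_notMem h]
  have hmeas : MeasurableSet ((fun z : E => ‖z‖) ⁻¹' S) := measurable_norm hS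
  calc ∫⁻ z in (fun z : E => ‖z‖) ⁻¹' S, ENNReal.ofReal (‖z‖ ^ (-l)) ∂μ
      = ∫⁻ z, ENNReal.ofReal (f ‖z‖) ∂μ := by
        rw [← lintegral_indicator hmeas]
        refine lintegral_congr fun z => ?_
        by_cases h : ‖z‖ ∈ S
        · simp [f, indicator, h]
        · simp [f, indicator, h]
    _ = _ := by
        rw [← ofReal_integral_eq_lintegral_ofReal hintE hpos, integral_fun_norm_addHaar μ f,
          ← setIntegral_congr_fun measurableSet_Ioi hrw, setIntegral_indicator hS]
        simp

omit [BorelSpace E] [Nontrivial E] in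
theorem measureReal_unitBall_pos : 0 < μ.real (ball (0 : E) 1) :=
  ENNReal.toReal_pos (measure_ball_pos μ _ one_pos).ne' measure_ball_lt_top.ne

/-- A Riesz kernel with exponent below the dimension is integrable near its pole. -/
theorem exists_lintegral_ball_rpow_norm_le {l : ℝ} (hl : l < finrank ℝ E) :
    ∃ C : ℝ, 0 < C ∧ ∀ R : ℝ, 0 < R →
      ∫⁻ z in ball (0 : E) R, ENNReal.ofReal (‖z‖ ^ (-l)) ∂μ ≤
        ENNReal.ofReal (C * R ^ ((finrank ℝ E : ℝ) - l)) := by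
  have hd : (0 : ℝ) < finrank ℝ E := Nat.cast_pos.2 (finrank_pos (R := ℝ) (M := E))
  have hm := measureReal_unitBall_pos (E := E) μ
  set d : ℝ := (finrank ℝ E : ℝ)
  have hdl : 0 < d - l := sub_pos.2 hl
  refine ⟨d * (μ.real (ball 0 1) * (d - l)⁻¹), by positivity, fun R hR => ?_⟩
  have hset : Ioi (0 : ℝ) ∩ Iio R = Ioo 0 R := rfl
  have hball : ball (0 : E) R = (fun z : E => ‖z‖) ⁻¹' Iio R := by ext; simp
  rw [hball, setLIntegral_rpow_norm μ measurableSet_Iio, hset,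
    ← integral_Ioc_eq_integral_Ioo, ← intervalIntegral.integral_of_le hR.le,
    integral_rpow (Or.inl (by linarith)), Real.zero_rpow (by linarith)]
  · apply le_of_eq
    congr 1
    rw [show d - 1 - l + 1 = d - l by ring]
    field_simp
    ring
  · rw [hset, intervalIntegral.integrableOn_Ioo_rpow_iff hR]
    linarith

/-- A Riesz kernel with exponent above the dimension is integrable at infinity. -/
theorem exists_lintegral_compl_ball_rpow_norm_le {l : ℝ} (hl : finrank ℝ E < l) :
    ∃ C : ℝ, 0 < C ∧ ∀ R : ℝ, 0 < R →
      ∫⁻ z in (ball (0 : E) R)ᶜ, ENNReal.ofReal (‖z‖ ^ (-l)) ∂μ ≤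
        ENNReal.ofReal (C * R ^ ((finrank ℝ E : ℝ) - l)) := by
  have hd : (0 : ℝ) < finrank ℝ E := Nat.cast_pos.2 (finrank_pos (R := ℝ) (M := E))
  have hm := measureReal_unitBall_pos (E := E) μ
  set d : ℝ := (finrank ℝ E : ℝ)
  have hdl : 0 < l - d := sub_pos.2 hl
  refine ⟨d * (μ.real (ball 0 1) * (l - d)⁻¹), by positivity, fun R hR => ?_⟩
  have hset : Ioi (0 : ℝ) ∩ Ici R = Ici R :=
    inter_eq_right.2 fun y (hy : R ≤ y) => hR.trans_le hy
  have hball : (ball (0 : E) R)ᶜ = (fun z : E => ‖z‖) ⁻¹' Ici R := by ext; simp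
  rw [hball, setLIntegral_rpow_norm μ measurableSet_Ici, hset, integral_Ici_eq_integral_Ioi,
    integral_Ioi_rpow_of_lt (by linarith) hR]
  · apply le_of_eq
    congr 1
    have h1 : d - l ≠ 0 := by linarith
    rw [show d - 1 - l + 1 = d - l by ring, show l - d = -(d - l) by ring]
    field_simp
    rfl
  · rw [hset, integrableOn_Ici_iff_integrableOn_Ioi]
    exact integrableOn_Ioi_rpow_of_lt (by linarith) hR

end Radial

/-! ### Layer cake with values in `[0, ∞]` -/

theorem ofReal_rpow_eq_lintegral {g : ℝ} (hg : 0 < g) {b : ℝ} (hb : 0 ≤ b) :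
    ENNReal.ofReal b ^ g =
      ENNReal.ofReal g * ∫⁻ t in Ioi (0 : ℝ),
        if ENNReal.ofReal t < ENNReal.ofReal b then ENNReal.ofReal (t ^ (g - 1)) else 0 := by
  have hint : IntegrableOn (fun t : ℝ => t ^ (g - 1)) (Ioc 0 b) := by
    rw [← intervalIntegrable_iff_integrableOn_Ioc_of_le hb]
    exact intervalIntegral.intervalIntegrable_rpow' (by linarith)
  have hnn : 0 ≤ᵐ[volume.restrict (Ioc 0 b)] fun t : ℝ => t ^ (g - 1) := by
    filter_upwards [ae_restrict_mem measurableSet_Ioc] with t ht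
    exact Real.rpow_nonneg ht.1.le _
  have h1 : ∫⁻ t in Ioi (0 : ℝ),
      (if ENNReal.ofReal t < ENNReal.ofReal b then ENNReal.ofReal (t ^ (g - 1)) else 0) =
      ∫⁻ t in Ioo 0 b, ENNReal.ofReal (t ^ (g - 1)) := by
    rw [← lintegral_indicator measurableSet_Ioi, ← lintegral_indicator measurableSet_Ioo]
    refine lintegral_congr fun t => ?_
    by_cases h0 : 0 < t
    · have : ENNReal.ofReal t < ENNReal.ofReal b ↔ t < b := by
        rw [ENNReal.ofReal_lt_ofReal_iff']
        exact ⟨And.left, fun h => ⟨h, h0.trans h⟩⟩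
      simp [indicator, h0, this]
    · simp [indicator, h0]
  rw [h1, restrict_Ioo_eq_restrict_Ioc, ← ofReal_integral_eq_lintegral_ofReal hint hnn,
    ← intervalIntegral.integral_of_le hb, integral_rpow (Or.inl (by linarith)),
    ← ENNReal.ofReal_mul hg.le, ENNReal.ofReal_rpow_of_nonneg hb hg.le]
  congr 1
  rw [sub_add_cancel, Real.zero_rpow hg.ne']
  field_simp
  ring

theorem ennreal_rpow_eq_lintegral {g : ℝ} (hg : 0 < g) (a : ℝ≥0∞) :
    a ^ g = ENNReal.ofReal g * ∫⁻ t in Ioi (0 : ℝ),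
        if ENNReal.ofReal t < a then ENNReal.ofReal (t ^ (g - 1)) else 0 := by
  induction a with
  | coe b =>
    have := ofReal_rpow_eq_lintegral hg b.coe_nonneg
    simpa using this
  | top =>
    rw [ENNReal.top_rpow_of_pos hg]
    -- The integral at `⊤` dominates the one at each finite level, and those realise every
    -- nonnegative real `r`.
    refine (ENNReal.eq_top_of_forall_nnreal_le fun r => ?_).symm
    have hr : (r : ℝ≥0∞) = ENNReal.ofReal ((r : ℝ) ^ (1 / g)) ^ g := by
      rw [ENNReal.ofReal_rpow_of_nonneg (by positivity) hg.le, ← Real.rpow_mul r.coe_nonneg,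
        one_div, inv_mul_cancel₀ hg.ne', Real.rpow_one, ENNReal.ofReal_coe_nnreal]
    rw [hr, ofReal_rpow_eq_lintegral hg (by positivity)]
    gcongr with t
    split_ifs <;> simp_all

/-- The layer cake formula for functions with values in `[0, ∞]`. -/
theorem lintegral_rpow_eq_lintegral_meas_ofReal_lt {α : Type*} [MeasurableSpace α] {ν : Measure α}
    [SFinite ν] {F : α → ℝ≥0∞} (hF : Measurable F) {g : ℝ} (hg : 0 < g) :
    ∫⁻ x, F x ^ g ∂ν = ENNReal.ofReal g *
      ∫⁻ t in Ioi (0 : ℝ), ENNReal.ofReal (t ^ (g - 1)) * ν {x | ENNReal.ofReal t < F x} := by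
  have hm : Measurable (Function.uncurry fun (x : α) (t : ℝ) =>
      if ENNReal.ofReal t < F x then ENNReal.ofReal (t ^ (g - 1)) else 0) := by
    refine Measurable.ite (measurableSet_lt (by fun_prop) (by fun_prop)) ?_ measurable_const
    fun_prop
  simp_rw [ennreal_rpow_eq_lintegral hg]
  rw [lintegral_const_mul _ hm.lintegral_prod_right, lintegral_lintegral_swap hm.aemeasurable]
  congr 1
  refine lintegral_congr fun t => ?_
  have hs : MeasurableSet {x | ENNReal.ofReal t < F x} := measurableSet_lt measurable_const hF
  rw [← lintegral_indicator_const hs]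
  refine lintegral_congr fun x => ?_
  simp [indicator]

theorem eLpNorm_ofReal {α : Type*} [MeasurableSpace α] {μ : Measure α} {r : ℝ} (hr : 0 < r)
    (g : α → ℝ≥0∞) :
    eLpNorm g (ENNReal.ofReal r) μ = (∫⁻ x, g x ^ r ∂μ) ^ (1 / r) := by
  rw [eLpNorm_eq_lintegral_rpow_enorm_toReal (by simpa using hr) ENNReal.ofReal_ne_top,
    ENNReal.toReal_ofReal hr.le]
  simp

/-! ### Hardy–Littlewood–Sobolev inequality -/

section HLS

variable {E : Type*} [NormedAddCommGroup E] [NormedSpace ℝ E] [FiniteDimensional ℝ E]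
  [MeasurableSpace E] [BorelSpace E]

/-- The Riesz kernel `|x - y|^{-l}` with values in `[0, ∞]`. -/
noncomputable def rieszKernel (l : ℝ) (z : E) : ℝ≥0∞ := ENNReal.ofReal (‖z‖ ^ (-l))

omit [NormedSpace ℝ E] [FiniteDimensional ℝ E] in
@[fun_prop]
theorem measurable_rieszKernel (l : ℝ) : Measurable (rieszKernel l : E → ℝ≥0∞) := by
  unfold rieszKernel
  fun_prop

theorem measurable_rieszKernel_mul (l : ℝ) {g : E → ℝ≥0∞} (hg : Measurable g) :
    Measurable (Function.uncurry fun x y : E => rieszKernel l (x - y) * g y) :=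
  ((measurable_rieszKernel l).comp (measurable_fst.sub measurable_snd)).mul
    (hg.comp measurable_snd)

theorem lintegral_indicator_sub (μ : Measure E) [μ.IsAddHaarMeasure] (k : E → ℝ≥0∞) {S : Set E}
    (hS : MeasurableSet S) (x : E) :
    ∫⁻ y, S.indicator k (x - y) ∂μ = ∫⁻ z in S, k z ∂μ := by
  rw [lintegral_sub_left_eq_self (fun z => S.indicator k z) x, lintegral_indicator hS]

variable [Nontrivial E] (μ : Measure E) [μ.IsAddHaarMeasure]

theorem exists_lintegral_near_le {l : ℝ} (hl : l < finrank ℝ E) :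
    ∃ C : ℝ, 0 < C ∧ ∀ R : ℝ, 0 < R →
      ∫⁻ z in ball (0 : E) R, rieszKernel l z ∂μ ≤
        ENNReal.ofReal (C * R ^ ((finrank ℝ E : ℝ) - l)) :=
  exists_lintegral_ball_rpow_norm_le μ hl

/-- Hölder: the condition on `l` says `l p' > d`, so the `p'`-th power of the kernel is integrable
away from its pole. -/
theorem exists_lintegral_far_mul_le {l p : ℝ} (hp : 1 < p)
    (hl : (finrank ℝ E : ℝ) * (1 - 1 / p) < l) :
    ∃ C : ℝ, 0 < C ∧ ∀ R : ℝ, 0 < R → ∀ f : E → ℝ≥0∞, Measurable f → ∫⁻ y, f y ^ p ∂μ ≤ 1 →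
      ∀ x, ∫⁻ y, (ball (0 : E) R)ᶜ.indicator (rieszKernel l) (x - y) * f y ∂μ ≤
        ENNReal.ofReal (C * R ^ ((finrank ℝ E : ℝ) * (1 - 1 / p) - l)) := by
  set d : ℝ := (finrank ℝ E : ℝ) with hd
  set p' : ℝ := p / (p - 1) with hp'
  have hp0 : 0 < p := by linarith
  have hp1 : 0 < p - 1 := by linarith
  have hp'0 : 0 < p' := by positivity
  have hinv : 1 - 1 / p = 1 / p' := by rw [hp']; field_simp
  have hconj : p'.HolderConjugate p := (Real.HolderConjugate.conjExponent hp).symm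
  have hlp : d < l * p' := by
    rw [hinv] at hl
    rwa [mul_one_div, div_lt_iff₀ hp'0] at hl
  obtain ⟨C, hC, hCR⟩ := exists_lintegral_compl_ball_rpow_norm_le μ hlp
  refine ⟨C ^ (1 / p'), by positivity, fun R hR f hf hfp x => ?_⟩
  have hm : MeasurableSet (ball (0 : E) R)ᶜ := measurableSet_ball.compl
  have hk : Measurable fun y => (ball (0 : E) R)ᶜ.indicator (rieszKernel l) (x - y) :=
    ((measurable_rieszKernel l).indicator hm).comp (by fun_prop)
  refine (ENNReal.lintegral_mul_le_Lp_mul_Lq μ hconj hk.aemeasurable hf.aemeasurable).trans ?_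
  have h1 : ∫⁻ y, (ball (0 : E) R)ᶜ.indicator (rieszKernel l) (x - y) ^ p' ∂μ ≤
      ENNReal.ofReal (C * R ^ (d - l * p')) := by
    refine le_trans (le_of_eq ?_) (hCR R hR)
    rw [← lintegral_indicator_sub μ _ hm x]
    refine lintegral_congr fun y => ?_
    by_cases h : x - y ∈ (ball (0 : E) R)ᶜ
    · rw [indicator_of_mem h, indicator_of_mem h, rieszKernel,
        ENNReal.ofReal_rpow_of_nonneg (by positivity) hp'0.le, ← Real.rpow_mul (norm_nonneg _),
        neg_mul]
    · rw [indicator_of_notMem h, indicator_of_notMem h, ENNReal.zero_rpow_of_pos hp'0]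
  calc _ ≤ ENNReal.ofReal (C * R ^ (d - l * p')) ^ (1 / p') * 1 ^ (1 / p) := by gcongr
    _ = _ := by
      rw [ENNReal.one_rpow, mul_one, ENNReal.ofReal_rpow_of_nonneg (by positivity) (by positivity),
        Real.mul_rpow hC.le (by positivity), ← Real.rpow_mul hR.le, hinv]
      congr 3
      field_simp

/-- The distribution function estimate behind the Hardy–Littlewood–Sobolev inequality. -/
theorem exists_meas_riesz_lt_le {a p q : ℝ} (ha : 0 < a) (hp : 1 < p) (hq : 0 < q)
    (hpq : (finrank ℝ E : ℝ) / p - a = finrank ℝ E / q) :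
    ∃ M C : ℝ, 0 < M ∧ 0 < C ∧ ∀ f : E → ℝ≥0∞, Measurable f → ∫⁻ y, f y ^ p ∂μ ≤ 1 →
      ∀ t : ℝ, 0 < t →
        μ {x | ENNReal.ofReal t <
          (∫⁻ y, rieszKernel (finrank ℝ E - a) (x - y) * f y ∂μ) / ENNReal.ofReal M} ≤
        ENNReal.ofReal (C * t ^ (-(q / p))) *
          ∫⁻ y in {y | ENNReal.ofReal t < f y ^ (p / q)}, f y ∂μ := by
  have hd : (0 : ℝ) < finrank ℝ E := Nat.cast_pos.2 (finrank_pos (R := ℝ) (M := E))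
  obtain ⟨C₀, hC₀, hnear⟩ := exists_lintegral_near_le (l := finrank ℝ E - a) μ (by linarith)
  obtain ⟨C₁, hC₁, hfar⟩ := exists_lintegral_far_mul_le (l := finrank ℝ E - a) (p := p) μ hp (by
    have : 0 < (finrank ℝ E : ℝ) / q := by positivity
    rw [mul_sub, mul_one, mul_one_div]
    linarith)
  set d : ℝ := (finrank ℝ E : ℝ) with hd'
  rw [sub_sub_cancel] at hnear
  have hp0 : 0 < p := by linarith
  have hqp : q / p = 1 + q * a / d := by
    field_simp at hpq ⊢
    linarith
  -- The far part and the near part of small `f` total at most `(C₁ + C₀) t`; the extra `1` leaves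
  -- height `t` for the near part of large `f`.
  refine ⟨C₁ + C₀ + 1, C₀, by positivity, hC₀, fun f hf hfp t ht => ?_⟩
  -- This radius balances the pieces: the far part has size `R^(-d/q) = t`, and the near part of `f
  -- ≤ t^(q/p)` has size `R^a t^(q/p) = t`.
  set R : ℝ := t ^ (-(q / d)) with hR'
  have hR : 0 < R := by positivity
  have hRa : R ^ a = t ^ (1 - q / p) := by
    rw [hR', ← Real.rpow_mul ht.le, hqp]
    congr 1
    field_simp
    ring
  set S : Set E := {y | ENNReal.ofReal t < f y ^ (p / q)} with hS'
  have hS : MeasurableSet S := measurableSet_lt measurable_const (hf.pow_const _)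
  set kn : E → ℝ≥0∞ := (ball (0 : E) R).indicator (rieszKernel (d - a)) with hkn'
  set kf : E → ℝ≥0∞ := (ball (0 : E) R)ᶜ.indicator (rieszKernel (d - a)) with hkf'
  have hkn : Measurable kn := (measurable_rieszKernel _).indicator measurableSet_ball
  have hkf : Measurable kf := (measurable_rieszKernel _).indicator measurableSet_ball.compl
  have hfb : ∀ y ∉ S, f y ≤ ENNReal.ofReal (t ^ (q / p)) := by
    intro y hy
    have hy' : f y ^ (p / q) ≤ ENNReal.ofReal t := not_lt.1 hy
    have := ENNReal.rpow_le_rpow hy' (by positivity : 0 ≤ q / p)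
    rwa [← ENNReal.rpow_mul, div_mul_div_cancel₀ hq.ne', div_self hp0.ne', ENNReal.rpow_one,
      ENNReal.ofReal_rpow_of_nonneg ht.le (by positivity)] at this
  have hsplit : ∀ x, ∫⁻ y, rieszKernel (d - a) (x - y) * f y ∂μ ≤
      ENNReal.ofReal ((C₁ + C₀) * t) + ∫⁻ y, kn (x - y) * S.indicator f y ∂μ := by
    intro x
    have hpt : ∀ y, rieszKernel (d - a) (x - y) * f y ≤
        kf (x - y) * f y + kn (x - y) * ENNReal.ofReal (t ^ (q / p)) +
          kn (x - y) * S.indicator f y := by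
      intro y
      by_cases hxy : x - y ∈ ball (0 : E) R
      · have h1 : kn (x - y) = rieszKernel (d - a) (x - y) := indicator_of_mem hxy _
        rw [← h1]
        by_cases hy : y ∈ S
        · rw [indicator_of_mem hy]
          exact le_add_self
        · refine le_add_right (le_add_left ?_)
          gcongr
          exact hfb y hy
      · have h1 : kf (x - y) = rieszKernel (d - a) (x - y) := indicator_of_mem hxy _
        rw [← h1]
        exact le_add_right (le_add_right le_rfl)
    refine (lintegral_mono hpt).trans ?_
    rw [lintegral_add_left (by fun_prop), lintegral_add_left (by fun_prop),
      lintegral_mul_const _ (by fun_prop), lintegral_indicator_sub μ _ measurableSet_ball]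
    gcongr
    calc _ ≤ ENNReal.ofReal (C₁ * R ^ (d * (1 - 1 / p) - (d - a))) +
          ENNReal.ofReal (C₀ * R ^ a) * ENNReal.ofReal (t ^ (q / p)) := by
          gcongr
          · exact hfar R hR f hf hfp x
          · exact hnear R hR
      _ = _ := by
          rw [← ENNReal.ofReal_mul (by positivity), ← ENNReal.ofReal_add (by positivity)
            (by positivity), hRa, mul_assoc, ← Real.rpow_add ht, hR', ← Real.rpow_mul ht.le]
          have h1 : -(q / d) * (d * (1 - 1 / p) - (d - a)) = 1 := by
            have : d * (1 - 1 / p) - (d - a) = - (d / q) := by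
              rw [← hpq]; ring
            rw [this]
            field_simp
          rw [h1, sub_add_cancel, Real.rpow_one]
          ring_nf
  have hsub : {x | ENNReal.ofReal t < (∫⁻ y, rieszKernel (d - a) (x - y) * f y ∂μ) /
      ENNReal.ofReal (C₁ + C₀ + 1)} ⊆
      {x | ENNReal.ofReal t ≤ ∫⁻ y, kn (x - y) * S.indicator f y ∂μ} := by
    intro x hx
    simp only [mem_ofPred_eq] at hx ⊢
    by_contra! hlt
    have h2 := (hsplit x).trans (add_le_add_right hlt.le _)
    rw [← ENNReal.ofReal_add (by positivity) ht.le,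
      show (C₁ + C₀) * t + t = t * (C₁ + C₀ + 1) by ring, ENNReal.ofReal_mul ht.le] at h2
    exact absurd (ENNReal.div_le_of_le_mul h2) (not_le.2 hx)
  have hprod : Measurable (Function.uncurry fun x y : E => kn (x - y) * S.indicator f y) := by
    have h1 : Measurable fun z : E × E => S.indicator f z.2 := (hf.indicator hS).comp measurable_snd
    have h2 : Measurable fun z : E × E => kn (z.1 - z.2) := hkn.comp (by fun_prop)
    exact h2.mul h1
  -- Only the near part of large `f` remains; Chebyshev and Tonelli control it through `L¹`.
  have hcheb := mul_meas_ge_le_lintegral (μ := μ) (hprod.lintegral_prod_right (ν := μ)) (ENNReal.ofReal t)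
  have htot : ∫⁻ x, ∫⁻ y, kn (x - y) * S.indicator f y ∂μ ∂μ ≤
      ENNReal.ofReal (C₀ * R ^ a) * ∫⁻ y in S, f y ∂μ := by
    rw [lintegral_lintegral_swap hprod.aemeasurable, ← lintegral_indicator hS,
      ← lintegral_const_mul _ (hf.indicator hS)]
    refine lintegral_mono fun y => ?_
    rw [lintegral_mul_const _ (by fun_prop), lintegral_sub_right_eq_self (fun z => kn z) y,
      lintegral_indicator measurableSet_ball]
    gcongr
    exact hnear R hR
  have ht0 : ENNReal.ofReal t ≠ 0 := by simpa using ht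
  calc _ ≤ μ {x | ENNReal.ofReal t ≤ ∫⁻ y, kn (x - y) * S.indicator f y ∂μ} := measure_mono hsub
    _ ≤ (ENNReal.ofReal (C₀ * R ^ a) * ∫⁻ y in S, f y ∂μ) / ENNReal.ofReal t := by
        rw [ENNReal.le_div_iff_mul_le (Or.inl ht0) (Or.inl ENNReal.ofReal_ne_top), mul_comm]
        exact hcheb.trans htot
    _ = _ := by
        rw [ENNReal.mul_div_right_comm, ← ENNReal.ofReal_div_of_pos ht, hRa, mul_div_assoc,
          ← Real.rpow_sub_one ht.ne']
        congr 4
        ring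

/-- Integrating the distribution estimate against `t^(q-1)` gives the strong bound directly, with no
interpolation: the right side is again a layer cake, for the measure `f μ`, and `(p/q)(q - q/p) = p
- 1` returns `∫ f^p`. -/
theorem exists_lintegral_riesz_rpow_le_of_le_one {a p q : ℝ} (ha : 0 < a) (hp : 1 < p)
    (hq : 0 < q) (hpq : (finrank ℝ E : ℝ) / p - a = finrank ℝ E / q) :
    ∃ C : ℝ, 0 < C ∧ ∀ f : E → ℝ≥0∞, Measurable f → ∫⁻ y, f y ^ p ∂μ ≤ 1 →
      ∫⁻ x, (∫⁻ y, rieszKernel (finrank ℝ E - a) (x - y) * f y ∂μ) ^ q ∂μ ≤ ENNReal.ofReal C := by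
  have hd : (0 : ℝ) < finrank ℝ E := Nat.cast_pos.2 (finrank_pos (R := ℝ) (M := E))
  obtain ⟨M, C, hM, hC, hdist⟩ := exists_meas_riesz_lt_le μ ha hp hq hpq
  have hp0 : 0 < p := by linarith
  set g : ℝ := q - q / p with hg'
  have hg : 0 < g := sub_pos.2 (div_lt_self hq hp)
  refine ⟨M ^ q * (q * (C * g⁻¹)), by positivity, fun f hf hfp => ?_⟩
  set T : E → ℝ≥0∞ := fun x => ∫⁻ y, rieszKernel (finrank ℝ E - a) (x - y) * f y ∂μ with hT'
  have hT : Measurable T := (measurable_rieszKernel_mul _ hf).lintegral_prod_right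
  have hM0 : ENNReal.ofReal M ≠ 0 := by simpa using hM
  have hTM : ∀ x, T x ^ q = ENNReal.ofReal (M ^ q) * (T x / ENNReal.ofReal M) ^ q := by
    intro x
    rw [← ENNReal.ofReal_rpow_of_pos hM, ← ENNReal.mul_rpow_of_nonneg _ _ hq.le,
      ENNReal.mul_div_cancel hM0 ENNReal.ofReal_ne_top]
  set ν : Measure E := μ.withDensity f with hν'
  have hlayer := lintegral_rpow_eq_lintegral_meas_ofReal_lt (ν := ν) (F := fun y => f y ^ (p / q))
    (hf.pow_const _) hg
  have hνf : ∫⁻ y, (f y ^ (p / q)) ^ g ∂ν ≤ 1 := by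
    rw [hν', lintegral_withDensity_eq_lintegral_mul _ hf (by fun_prop)]
    refine le_trans (le_of_eq (lintegral_congr fun y => ?_)) hfp
    have h1 : p / q * g = p - 1 := by rw [hg']; field_simp
    rw [Pi.mul_apply, ← ENNReal.rpow_mul, h1]
    nth_rewrite 1 [← ENNReal.rpow_one (f y)]
    rw [← ENNReal.rpow_add_of_nonneg _ _ zero_le_one (by linarith)]
    congr 1
    ring
  have hkey : ∫⁻ t in Ioi (0 : ℝ), ENNReal.ofReal (t ^ (g - 1)) *
      ν {y | ENNReal.ofReal t < f y ^ (p / q)} ≤ ENNReal.ofReal g⁻¹ := by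
    rw [ENNReal.ofReal_inv_of_pos hg, ← one_div, ENNReal.le_div_iff_mul_le
      (Or.inl (by simpa using hg)) (Or.inl ENNReal.ofReal_ne_top), mul_comm, ← hlayer]
    exact hνf
  have hbound : ∫⁻ t in Ioi (0 : ℝ), ENNReal.ofReal (t ^ (q - 1)) *
      μ {x | ENNReal.ofReal t < T x / ENNReal.ofReal M} ≤
      ENNReal.ofReal C * ENNReal.ofReal g⁻¹ := by
    refine le_trans ?_ (mul_le_mul_right hkey _)
    rw [← lintegral_const_mul' _ _ ENNReal.ofReal_ne_top]
    refine setLIntegral_mono' measurableSet_Ioi fun t (ht : 0 < t) => ?_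
    have hS : MeasurableSet {y | ENNReal.ofReal t < f y ^ (p / q)} :=
      measurableSet_lt measurable_const (hf.pow_const _)
    calc _ ≤ ENNReal.ofReal (t ^ (q - 1)) * (ENNReal.ofReal (C * t ^ (-(q / p))) *
          ∫⁻ y in {y | ENNReal.ofReal t < f y ^ (p / q)}, f y ∂μ) := by
          gcongr
          exact hdist f hf hfp t ht
      _ = _ := by
          rw [hν', withDensity_apply _ hS, ← mul_assoc, ← mul_assoc,
            ← ENNReal.ofReal_mul (by positivity), ← ENNReal.ofReal_mul hC.le]
          congr 2
          rw [mul_left_comm, ← Real.rpow_add ht]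
          congr 2
          rw [hg']
          ring
  calc ∫⁻ x, T x ^ q ∂μ
      = ENNReal.ofReal (M ^ q) * ∫⁻ x, (T x / ENNReal.ofReal M) ^ q ∂μ := by
        simp_rw [hTM]
        rw [lintegral_const_mul _ ((hT.div_const _).pow_const _)]
    _ ≤ ENNReal.ofReal (M ^ q) * (ENNReal.ofReal q * (ENNReal.ofReal C * ENNReal.ofReal g⁻¹)) := by
        rw [lintegral_rpow_eq_lintegral_meas_ofReal_lt (hT.div_const _) hq]
        gcongr
    _ = _ := by
        rw [← ENNReal.ofReal_mul hC.le, ← ENNReal.ofReal_mul hq.le,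
          ← ENNReal.ofReal_mul (by positivity)]

/-- The Hardy–Littlewood–Sobolev inequality for the Riesz potential of order `a`. -/
theorem exists_eLpNorm_riesz_le {a p q : ℝ} (ha : 0 < a) (hp : 1 < p)
    (hq : 0 < q) (hpq : (finrank ℝ E : ℝ) / p - a = finrank ℝ E / q) :
    ∃ C : ℝ, 0 < C ∧ ∀ f : E → ℝ≥0∞, Measurable f →
      eLpNorm (fun x => ∫⁻ y, rieszKernel (finrank ℝ E - a) (x - y) * f y ∂μ)
        (ENNReal.ofReal q) μ ≤ ENNReal.ofReal C * eLpNorm f (ENNReal.ofReal p) μ := by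
  obtain ⟨C, hC, hCf⟩ := exists_lintegral_riesz_rpow_le_of_le_one μ ha hp hq hpq
  have hp0 : 0 < p := by linarith
  refine ⟨C ^ (1 / q), by positivity, fun f hf => ?_⟩
  rw [eLpNorm_ofReal hq, eLpNorm_ofReal hp0]
  set A : ℝ≥0∞ := (∫⁻ x, f x ^ p ∂μ) ^ (1 / p) with hA
  have hAp : A ^ p = ∫⁻ x, f x ^ p ∂μ := by
    rw [hA, ← ENNReal.rpow_mul, one_div, inv_mul_cancel₀ hp0.ne', ENNReal.rpow_one]
  have hC0 : ENNReal.ofReal (C ^ (1 / q)) ≠ 0 := by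
    simpa using (by positivity : 0 < C ^ (1 / q))
  rcases eq_or_ne A ⊤ with htop | htop
  · rw [htop, ENNReal.mul_top hC0]
    exact le_top
  -- Homogeneity allows normalising by `A` unless it is `0` or `⊤`.
  rcases eq_or_ne A 0 with hzero | hzero
  · have hf0 : f =ᵐ[μ] 0 := by
      rw [hzero, ENNReal.zero_rpow_of_pos hp0] at hAp
      have := (lintegral_eq_zero_iff (hf.pow_const p)).1 hAp.symm
      filter_upwards [this] with x hx
      simpa [hp0, hp0.not_gt] using hx
    have hT0 : ∀ x, ∫⁻ y, rieszKernel (finrank ℝ E - a) (x - y) * f y ∂μ = 0 := by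
      intro x
      refine lintegral_eq_zero_of_ae_eq_zero ?_
      filter_upwards [hf0] with y hy
      simp [hy]
    simp [hT0, hq]
  · have hnorm : ∫⁻ y, (f y / A) ^ p ∂μ ≤ 1 := by
      simp_rw [ENNReal.div_rpow_of_nonneg _ _ hp0.le, div_eq_mul_inv]
      rw [lintegral_mul_const _ (hf.pow_const p), ← hAp]
      exact ENNReal.mul_inv_le_one _
    have hTA : ∀ x, ∫⁻ y, rieszKernel (finrank ℝ E - a) (x - y) * f y ∂μ =
        A * ∫⁻ y, rieszKernel (finrank ℝ E - a) (x - y) * (f y / A) ∂μ := by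
      intro x
      rw [← lintegral_const_mul' _ _ htop]
      refine lintegral_congr fun y => ?_
      rw [mul_left_comm, ENNReal.mul_div_cancel hzero htop]
    simp_rw [hTA, ENNReal.mul_rpow_of_nonneg _ _ hq.le]
    rw [lintegral_const_mul' _ _ (ENNReal.rpow_ne_top_of_nonneg hq.le htop),
      ENNReal.mul_rpow_of_nonneg _ _ (by positivity), ← ENNReal.rpow_mul, mul_one_div_cancel hq.ne',
      ENNReal.rpow_one, mul_comm, ← ENNReal.ofReal_rpow_of_pos hC]
    gcongr
    exact hCf _ (hf.div_const _) hnorm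

end HLS

/-! ### The one-dimensional integral in the Green function -/

section Profile

variable {s N : ℝ}

theorem intervalIntegrable_profile (hs : 0 < s) {a b : ℝ} (ha : 0 ≤ a) (hb : 0 ≤ b) :
    IntervalIntegrable (fun t : ℝ => t ^ (s - 1) / (1 + t) ^ N) volume a b := by
  simp_rw [div_eq_mul_inv]
  refine (intervalIntegral.intervalIntegrable_rpow' (by linarith)).mul_continuousOn ?_
  have hpos : ∀ t ∈ uIcc a b, 0 < 1 + t := fun t ht => by
    have := (le_min ha hb).trans ht.1
    linarith
  refine ContinuousOn.inv₀ (ContinuousOn.rpow_const (by fun_prop) fun t ht => ?_) fun t ht => ?_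
  · exact Or.inl (hpos t ht).ne'
  · exact (Real.rpow_pos_of_pos (hpos t ht) _).ne'

/-- Since `t^(s-b) ≤ (1+t)^N`, decay of the denominator can be traded for a smaller power. The
exponent `b` may be negative, which serves the tail on `[1, R]`. -/
theorem profile_le_rpow {t b : ℝ} (ht : 0 < t) (hbs : b ≤ s) (hbN : s - b ≤ N) :
    t ^ (s - 1) / (1 + t) ^ N ≤ t ^ (b - 1) := by
  rw [div_le_iff₀ (by positivity)]
  calc t ^ (s - 1) = t ^ (b - 1) * t ^ (s - b) := by
        rw [← Real.rpow_add ht]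
        congr 1
        ring
    _ ≤ t ^ (b - 1) * (1 + t) ^ N := by
        gcongr
        calc t ^ (s - b) ≤ (1 + t) ^ (s - b) :=
              Real.rpow_le_rpow ht.le (by linarith) (by linarith)
          _ ≤ (1 + t) ^ N := Real.rpow_le_rpow_of_exponent_le (by linarith) hbN

theorem integral_profile_nonneg {R : ℝ} (hR : 0 ≤ R) :
    0 ≤ ∫ t in (0 : ℝ)..R, t ^ (s - 1) / (1 + t) ^ N := by
  refine intervalIntegral.integral_nonneg hR fun t ht => ?_
  have := ht.1
  positivity

theorem integral_profile_le_rpow (hs : 0 < s) {b R : ℝ} (hR : 0 ≤ R) (hb : 0 < b) (hbs : b ≤ s)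
    (hbN : s - b ≤ N) :
    ∫ t in (0 : ℝ)..R, t ^ (s - 1) / (1 + t) ^ N ≤ R ^ b / b := by
  calc ∫ t in (0 : ℝ)..R, t ^ (s - 1) / (1 + t) ^ N
      ≤ ∫ t in (0 : ℝ)..R, t ^ (b - 1) := by
        refine intervalIntegral.integral_mono_on_of_le_Ioo hR
          (intervalIntegrable_profile hs le_rfl hR)
          (intervalIntegral.intervalIntegrable_rpow' (by linarith)) fun t ht => ?_
        exact profile_le_rpow ht.1 hbs hbN
    _ = R ^ b / b := by
        rw [integral_rpow (Or.inl (by linarith)), sub_add_cancel, Real.zero_rpow hb.ne', sub_zero]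

theorem integral_profile_le (hs : 0 < s) (hsN : s < N) {R : ℝ} (hR : 0 ≤ R) :
    ∫ t in (0 : ℝ)..R, t ^ (s - 1) / (1 + t) ^ N ≤ 1 / s + 1 / (N - s) := by
  have hNs : 0 < N - s := sub_pos.2 hsN
  have hfirst : ∀ {R : ℝ}, 0 ≤ R → R ≤ 1 →
      ∫ t in (0 : ℝ)..R, t ^ (s - 1) / (1 + t) ^ N ≤ 1 / s := fun h0 h1 =>
    (integral_profile_le_rpow hs h0 hs le_rfl (by linarith)).trans
      (by gcongr; exact Real.rpow_le_one h0 h1 hs.le)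
  rcases le_total R 1 with h1 | h1
  · exact (hfirst hR h1).trans (le_add_of_nonneg_right (by positivity))
  · rw [← intervalIntegral.integral_add_adjacent_intervals
      (intervalIntegrable_profile hs le_rfl zero_le_one)
      (intervalIntegrable_profile hs zero_le_one hR)]
    refine add_le_add (hfirst zero_le_one le_rfl) ?_
    have h0 : (0 : ℝ) ∉ uIcc 1 R := by
      rw [uIcc_of_le h1]
      exact fun h => absurd h.1 (by norm_num)
    calc ∫ t in (1 : ℝ)..R, t ^ (s - 1) / (1 + t) ^ N
        ≤ ∫ t in (1 : ℝ)..R, t ^ ((s - N) - 1) := by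
          refine intervalIntegral.integral_mono_on_of_le_Ioo h1
            (intervalIntegrable_profile hs zero_le_one hR)
            (intervalIntegral.intervalIntegrable_rpow (Or.inr h0)) fun t ht => ?_
          exact profile_le_rpow (by linarith [ht.1]) (by linarith) (by linarith)
      _ ≤ 1 / (N - s) := by
          rw [integral_rpow (Or.inr ⟨by linarith, h0⟩), sub_add_cancel, Real.one_rpow,
            ← neg_sub N s, div_neg, ← neg_div, neg_sub]
          gcongr
          linarith [Real.rpow_nonneg hR (-(N - s))]

end Profile

/-! ### Pointwise bounds for the Green function -/

section Green

variable {n : ℕ} {s : ℝ}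

theorem kappa_pos (hn : 1 ≤ n) (hs : 0 < s) : 0 < kappa n s := by
  have h1 : 0 < Real.Gamma ((n : ℝ) / 2) := Real.Gamma_pos_of_pos (by positivity)
  have h2 : 0 < Real.Gamma s := Real.Gamma_pos_of_pos hs
  unfold kappa
  positivity

theorem one_sub_norm_sq_mem {x : EuclideanSpace ℝ (Fin n)} (hx : x ∈ unitBall n) :
    0 < 1 - ‖x‖ ^ 2 ∧ 1 - ‖x‖ ^ 2 ≤ 1 := by
  have h : ‖x‖ < 1 := by simpa [unitBall] using hx
  constructor <;> nlinarith [norm_nonneg x]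

theorem rho_nonneg {x y : EuclideanSpace ℝ (Fin n)} (hx : x ∈ unitBall n) (hy : y ∈ unitBall n) :
    0 ≤ rho x y := by
  have h1 := (one_sub_norm_sq_mem hx).1
  have h2 := (one_sub_norm_sq_mem hy).1
  unfold rho
  positivity

/-- Division by zero gives `rho x x = 0`, so kernel bounds need no exception on the diagonal. -/
theorem green_self (x : EuclideanSpace ℝ (Fin n)) : green s x x = 0 := by
  simp [green, rho]

theorem green_nonneg (hn : 1 ≤ n) (hs : 0 < s) {x y : EuclideanSpace ℝ (Fin n)}
    (hx : x ∈ unitBall n) (hy : y ∈ unitBall n) : 0 ≤ green s x y := by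
  have := kappa_pos hn hs
  exact mul_nonneg (by positivity) (integral_profile_nonneg (rho_nonneg hx hy))

/-- The choice `b = s` gives full boundary decay; smaller `b` gives a weaker singularity at the
pole. -/
theorem green_le_mul_rpow (hn : 1 ≤ n) (hs : 0 < s) {b : ℝ} (hb : 0 < b) (hbs : b ≤ s)
    (hbn : s - b ≤ (n : ℝ) / 2) {x y : EuclideanSpace ℝ (Fin n)}
    (hx : x ∈ unitBall n) (hy : y ∈ unitBall n) (hxy : x ≠ y) :
    green s x y ≤ kappa n s / b * ((1 - ‖x‖ ^ 2) * (1 - ‖y‖ ^ 2)) ^ b *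
      ‖x - y‖ ^ (2 * s - n - 2 * b) := by
  have hk := kappa_pos hn hs
  have h1 := (one_sub_norm_sq_mem hx).1
  have h2 := (one_sub_norm_sq_mem hy).1
  have hm : 0 < ‖x - y‖ := norm_pos_iff.2 (sub_ne_zero.2 hxy)
  calc green s x y ≤ kappa n s / ‖x - y‖ ^ ((n : ℝ) - 2 * s) * (rho x y ^ b / b) := by
        unfold green
        gcongr
        exact integral_profile_le_rpow hs (rho_nonneg hx hy) hb hbs hbn
    _ = _ := by
        rw [rho, Real.div_rpow (by positivity) (by positivity),
          show (2 * s - n - 2 * b) = -((n : ℝ) - 2 * s) - 2 * b by ring,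
          Real.rpow_sub hm (-((n : ℝ) - 2 * s)), Real.rpow_neg hm.le, Real.rpow_mul hm.le 2 b, Real.rpow_two]
        field_simp

/-- The Green function is dominated by a Riesz kernel. -/
theorem exists_green_le_rpow (hn : 1 ≤ n) (hs : 0 < s) {a : ℝ} (ha0 : 0 ≤ a) (han : a ≤ n)
    (ha : (n : ℝ) - 2 * s < a ∨ (2 * s < n ∧ a = n - 2 * s)) :
    ∃ C : ℝ, 0 < C ∧ ∀ x ∈ unitBall n, ∀ y ∈ unitBall n, x ≠ y →
      green s x y ≤ C * ‖x - y‖ ^ (-a) := by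
  have hk := kappa_pos hn hs
  rcases ha with ha | ⟨hns, rfl⟩
  · have hb : 0 < s - (n - a) / 2 := by linarith
    refine ⟨kappa n s / (s - (n - a) / 2), by positivity, fun x hx y hy hxy => ?_⟩
    obtain ⟨h1, h1'⟩ := one_sub_norm_sq_mem hx
    obtain ⟨h2, h2'⟩ := one_sub_norm_sq_mem hy
    refine (green_le_mul_rpow hn hs hb (by linarith) (by linarith) hx hy hxy).trans ?_
    rw [show 2 * s - n - 2 * (s - (n - a) / 2) = -a by ring]
    gcongr
    refine mul_le_of_le_one_right (by positivity) (Real.rpow_le_one (by positivity) ?_ hb.le)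
    exact mul_le_one₀ h1' h2.le h2'
  · have h0 : 0 < (n : ℝ) / 2 - s := by linarith
    refine ⟨kappa n s * (1 / s + 1 / ((n : ℝ) / 2 - s)), by positivity, fun x hx y hy hxy => ?_⟩
    have hm : 0 < ‖x - y‖ := norm_pos_iff.2 (sub_ne_zero.2 hxy)
    calc green s x y ≤ kappa n s / ‖x - y‖ ^ ((n : ℝ) - 2 * s) *
          (1 / s + 1 / ((n : ℝ) / 2 - s)) := by
          unfold green
          gcongr
          exact integral_profile_le hs (by linarith) (rho_nonneg hx hy)
      _ = _ := by
          rw [Real.rpow_neg hm.le]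
          ring

theorem bdryDist_le_add (Ω : Set (EuclideanSpace ℝ (Fin n))) (x y : EuclideanSpace ℝ (Fin n)) :
    bdryDist Ω x ≤ bdryDist Ω y + ‖x - y‖ := by
  rw [← dist_eq_norm]
  exact infDist_le_infDist_add_dist

theorem one_sub_norm_le_bdryDist (hn : 1 ≤ n) (x : EuclideanSpace ℝ (Fin n)) :
    1 - ‖x‖ ≤ bdryDist (unitBall n) x := by
  -- `infDist` to an empty set is `0`, so `1 ≤ n` matters here.
  have hne : ((unitBall n)ᶜ).Nonempty := by
    refine ⟨EuclideanSpace.single ⟨0, hn⟩ 1, ?_⟩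
    simp [unitBall]
  refine (le_infDist hne).2 fun y hy => ?_
  have hy' : 1 ≤ ‖y‖ := by simpa [unitBall] using hy
  have := norm_sub_norm_le y x
  rw [dist_eq_norm, norm_sub_rev]
  linarith

theorem bdryDist_pos (hn : 1 ≤ n) {x : EuclideanSpace ℝ (Fin n)} (hx : x ∈ unitBall n) :
    0 < bdryDist (unitBall n) x := by
  have h : ‖x‖ < 1 := by simpa [unitBall] using hx
  linarith [one_sub_norm_le_bdryDist hn x]

theorem one_sub_norm_sq_le (hn : 1 ≤ n) {x : EuclideanSpace ℝ (Fin n)} (hx : x ∈ unitBall n) :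
    1 - ‖x‖ ^ 2 ≤ 2 * bdryDist (unitBall n) x := by
  have h : ‖x‖ < 1 := by simpa [unitBall] using hx
  nlinarith [one_sub_norm_le_bdryDist hn x, norm_nonneg x]

theorem rpow_le_two_of_mem {u r : ℝ} (hu : 1 / 2 ≤ u) (hu' : u ≤ 2) (hr : -1 ≤ r) (hr' : r ≤ 1) :
    u ^ r ≤ 2 := by
  have h2 : ∀ e : ℝ, e ≤ 1 → (2 : ℝ) ^ e ≤ 2 := fun e he => by
    simpa using Real.rpow_le_rpow_of_exponent_le one_le_two he
  rcases le_total 0 r with h | h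
  · exact (Real.rpow_le_rpow (by linarith) hu' h).trans (h2 r hr')
  · calc u ^ r ≤ (1 / 2 : ℝ) ^ r := Real.rpow_le_rpow_of_nonpos (by norm_num) hu h
      _ = 2 ^ (-r) := by rw [one_div, Real.inv_rpow (by norm_num), Real.rpow_neg (by norm_num)]
      _ ≤ 2 := h2 _ (by linarith)

theorem norm_sub_lt_two {x y : EuclideanSpace ℝ (Fin n)} (hx : x ∈ unitBall n)
    (hy : y ∈ unitBall n) : ‖x - y‖ < 2 := by
  have h1 : ‖x‖ < 1 := by simpa [unitBall] using hx
  have h2 : ‖y‖ < 1 := by simpa [unitBall] using hy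
  linarith [norm_sub_le x y]

/-- Conjugating the Green function with a power `r ∈ [-s, s]` of the distance to the boundary
keeps it below a Riesz kernel, uniformly in `r`. -/
theorem exists_weighted_green_le (hn : 1 ≤ n) (hs : 0 < s) (hs1 : s < 1) {a : ℝ} (ha0 : 0 ≤ a)
    (han : a ≤ n) (ha : (n : ℝ) - 2 * s < a ∨ (2 * s < n ∧ a = n - 2 * s)) :
    ∃ C : ℝ, 0 < C ∧ ∀ r : ℝ, -s ≤ r → r ≤ s → ∀ x ∈ unitBall n, ∀ y ∈ unitBall n,
      bdryDist (unitBall n) x ^ r * green s x y ≤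
        C * ‖x - y‖ ^ (-a) * bdryDist (unitBall n) y ^ r := by
  have hk := kappa_pos hn hs
  obtain ⟨C₁, hC₁, hnear⟩ := exists_green_le_rpow hn hs ha0 han ha
  have hal : (n : ℝ) - 2 * s ≤ a := by
    rcases ha with h | ⟨-, h⟩
    · exact h.le
    · exact h.ge
  -- The factors come from `b = s`, from `1 - |x|² ≤ 2δ(x)` at both points, from `(2m)^(2s)`, and
  -- from `m < 2`.
  set C₂ : ℝ := kappa n s / s * (2 ^ s * 2 ^ s * 2 ^ (2 * s) * 2 ^ (a - (n - 2 * s))) with hC₂'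
  have hC₂ : 0 < C₂ := by positivity
  refine ⟨2 * C₁ + C₂, by positivity, fun r hr hr' x hx y hy => ?_⟩
  have hdx := bdryDist_pos hn hx
  have hdy := bdryDist_pos hn hy
  have hxl := one_sub_norm_sq_le hn hx
  have hyl := one_sub_norm_sq_le hn hy
  have hxp := (one_sub_norm_sq_mem hx).1
  have hyp := (one_sub_norm_sq_mem hy).1
  have h12 := bdryDist_le_add (unitBall n) x y
  have h21 := bdryDist_le_add (unitBall n) y x
  rw [norm_sub_rev] at h21
  have hm2 := norm_sub_lt_two hx hy
  set u := bdryDist (unitBall n) x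
  set v := bdryDist (unitBall n) y
  rcases eq_or_ne x y with rfl | hxy
  · rw [green_self, mul_zero]
    positivity
  have hm : 0 < ‖x - y‖ := norm_pos_iff.2 (sub_ne_zero.2 hxy)
  have hg1 := hnear x hx y hy hxy
  have hg2 := green_le_mul_rpow hn hs hs le_rfl (by simp; positivity) hx hy hxy
  set m := ‖x - y‖
  have hdiv : u ^ r = (u / v) ^ r * v ^ r := by
    rw [← Real.mul_rpow (by positivity) hdy.le, div_mul_cancel₀ _ hdy.ne']
  by_cases hcase : u ≤ 2 * m ∧ v ≤ 2 * m
  · have hprod : ((1 - ‖x‖ ^ 2) * (1 - ‖y‖ ^ 2)) ^ s ≤ 2 ^ s * 2 ^ s * (u ^ s * v ^ s) := by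
      calc _ ≤ ((2 * u) * (2 * v)) ^ s := by gcongr
        _ = _ := by
          rw [Real.mul_rpow (by positivity) (by positivity), Real.mul_rpow (by positivity) hdx.le,
            Real.mul_rpow (by positivity) hdy.le]
          ring
    -- The range of `r` is used here: `s + r` and `s - r` are both nonnegative.
    have huv : u ^ r * (u ^ s * v ^ s) ≤ 2 ^ (2 * s) * m ^ (2 * s) * v ^ r := by
      calc u ^ r * (u ^ s * v ^ s) = u ^ (s + r) * v ^ (s - r) * v ^ r := by
            rw [Real.rpow_add hdx, mul_assoc, ← Real.rpow_add hdy]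
            ring_nf
        _ ≤ (2 * m) ^ (s + r) * (2 * m) ^ (s - r) * v ^ r := by
            have e1 : 0 ≤ s + r := by linarith
            have e2 : 0 ≤ s - r := by linarith
            have b1 := hcase.1
            have b2 := hcase.2
            gcongr
        _ = _ := by
            rw [← Real.rpow_add (by positivity), ← Real.mul_rpow (by positivity) hm.le]
            congr 2
            ring
    have hmm : m ^ (2 * s) * m ^ (2 * s - n - 2 * s) ≤ 2 ^ (a - (n - 2 * s)) * m ^ (-a) := by
      rw [← Real.rpow_add hm]
      calc m ^ (2 * s + (2 * s - n - 2 * s)) = m ^ (a - (n - 2 * s)) * m ^ (-a) := by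
            rw [← Real.rpow_add hm]
            congr 1
            ring
        _ ≤ _ := by
            have e3 : 0 ≤ a - (n - 2 * s) := by linarith
            gcongr
    calc u ^ r * green s x y
        ≤ u ^ r * (kappa n s / s * (2 ^ s * 2 ^ s * (u ^ s * v ^ s)) *
          m ^ (2 * s - n - 2 * s)) := by
          gcongr
          exact hg2.trans (by gcongr)
      _ = kappa n s / s * (2 ^ s * 2 ^ s) * (u ^ r * (u ^ s * v ^ s)) *
          m ^ (2 * s - n - 2 * s) := by ring
      _ ≤ kappa n s / s * (2 ^ s * 2 ^ s) * (2 ^ (2 * s) * m ^ (2 * s) * v ^ r) *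
          m ^ (2 * s - n - 2 * s) := by gcongr
      _ = kappa n s / s * (2 ^ s * 2 ^ s * 2 ^ (2 * s)) *
          (m ^ (2 * s) * m ^ (2 * s - n - 2 * s)) * v ^ r := by ring
      _ ≤ kappa n s / s * (2 ^ s * 2 ^ s * 2 ^ (2 * s)) *
          (2 ^ (a - (n - 2 * s)) * m ^ (-a)) * v ^ r := by gcongr
      _ = C₂ * m ^ (-a) * v ^ r := by rw [hC₂']; ring
      _ ≤ (2 * C₁ + C₂) * m ^ (-a) * v ^ r := by
          gcongr
          linarith
  -- If one distance exceeds `2m`, the Lipschitz bound changes it by less than half of itself.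
  · have hcmp : v ≤ 2 * u ∧ u ≤ 2 * v := by
      rw [not_and_or, not_le, not_le] at hcase
      rcases hcase with h | h <;> constructor <;> linarith
    have hratio : (u / v) ^ r ≤ 2 := by
      refine rpow_le_two_of_mem ?_ ?_ (by linarith) (by linarith)
      · rw [div_le_div_iff₀ two_pos hdy]
        linarith [hcmp.1]
      · rw [div_le_iff₀ hdy]
        exact hcmp.2
    calc u ^ r * green s x y ≤ 2 * v ^ r * (C₁ * m ^ (-a)) := by
          rw [hdiv]
          have := green_nonneg hn hs hx hy
          gcongr
      _ = 2 * C₁ * m ^ (-a) * v ^ r := by ring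
      _ ≤ (2 * C₁ + C₂) * m ^ (-a) * v ^ r := by
          gcongr
          linarith

end Green

/-! ### From Riesz potentials to weighted Green potentials -/

section Transfer

variable {n : ℕ} {s : ℝ}

/-- Without integrability of `F` the primitive need not be continuous, so it is written with
integrals over measurable planar regions depending on a parameter. -/
theorem measurable_intervalIntegral_upper {F : ℝ → ℝ} (hF : Measurable F) :
    Measurable fun R : ℝ => ∫ t in (0 : ℝ)..R, F t := by
  have haux : ∀ S : Set (ℝ × ℝ), MeasurableSet S →
      Measurable fun R : ℝ => ∫ t, S.indicator (fun z : ℝ × ℝ => F z.2) (R, t) := fun S hS =>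
    (((hF.comp measurable_snd).indicator hS).stronglyMeasurable.integral_prod_right'
      (ν := volume)).measurable
  have h1 : MeasurableSet {z : ℝ × ℝ | 0 < z.2 ∧ z.2 ≤ z.1} :=
    (measurableSet_lt measurable_const measurable_snd).inter
      (measurableSet_le measurable_snd measurable_fst)
  have h2 : MeasurableSet {z : ℝ × ℝ | z.1 < z.2 ∧ z.2 ≤ 0} :=
    (measurableSet_lt measurable_fst measurable_snd).inter
      (measurableSet_le measurable_snd measurable_const)
  have heq : (fun R : ℝ => ∫ t in (0 : ℝ)..R, F t) = fun R =>
      (∫ t, {z : ℝ × ℝ | 0 < z.2 ∧ z.2 ≤ z.1}.indicator (fun z : ℝ × ℝ => F z.2) (R, t)) -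
      ∫ t, {z : ℝ × ℝ | z.1 < z.2 ∧ z.2 ≤ 0}.indicator (fun z : ℝ × ℝ => F z.2) (R, t) := by
    funext R
    rw [intervalIntegral, ← integral_indicator measurableSet_Ioc,
      ← integral_indicator measurableSet_Ioc]
    rfl
  rw [heq]
  exact (haux _ h1).sub (haux _ h2)

theorem measurable_green :
    Measurable fun z : EuclideanSpace ℝ (Fin n) × EuclideanSpace ℝ (Fin n) =>
      green s z.1 z.2 := by
  have h1 : Measurable fun z : EuclideanSpace ℝ (Fin n) × EuclideanSpace ℝ (Fin n) =>
      rho z.1 z.2 := by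
    unfold rho
    fun_prop
  have h2 : Measurable fun t : ℝ => t ^ (s - 1) / (1 + t) ^ ((n : ℝ) / 2) := by fun_prop
  have h3 := (measurable_intervalIntegral_upper h2).comp h1
  unfold green
  exact Measurable.mul (by fun_prop) h3

theorem measurable_green_right (x : EuclideanSpace ℝ (Fin n)) :
    Measurable fun y => green s x y := by
  have h : Measurable (Function.uncurry (green (n := n) s)) := measurable_green
  exact h.of_uncurry_left

theorem measurableSet_unitBall : MeasurableSet (unitBall n) := measurableSet_ball

theorem isOpen_unitBall : IsOpen (unitBall n) := isOpen_ball

theorem volume_unitBall_lt_top : volume (unitBall n) < ⊤ := measure_ball_lt_top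

theorem continuous_bdryDist (Ω : Set (EuclideanSpace ℝ (Fin n))) : Continuous (bdryDist Ω) :=
  continuous_infDist_pt _

theorem aestronglyMeasurable_greenPotential {f : EuclideanSpace ℝ (Fin n) → ℝ}
    (hf : AEStronglyMeasurable f (volume.restrict (unitBall n))) :
    AEStronglyMeasurable (greenPotential s f) (volume.restrict (unitBall n)) := by
  have h1 : AEStronglyMeasurable
      (fun z : EuclideanSpace ℝ (Fin n) × EuclideanSpace ℝ (Fin n) => f z.2 * green s z.1 z.2)
      ((volume.restrict (unitBall n)).prod (volume.restrict (unitBall n))) :=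
    hf.comp_snd.mul measurable_green.aestronglyMeasurable
  refine h1.integral_prod_right'.congr ?_
  filter_upwards [ae_restrict_mem measurableSet_unitBall] with x hx
  simp [greenPotential, hx]

/-- On a finite measure space `L^q ⊆ L¹`, and `δ^(-r)` is continuous inside the ball, hence locally
bounded. -/
theorem locallyIntegrableOn_of_weightedNorm_lt_top (hn : 1 ≤ n) {r : ℝ} {q : ℝ≥0∞} (hq : 1 ≤ q)
    {u : EuclideanSpace ℝ (Fin n) → ℝ}
    (hu : AEStronglyMeasurable u (volume.restrict (unitBall n)))
    (hfin : weightedNorm (unitBall n) r q u < ⊤) :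
    LocallyIntegrableOn u (unitBall n) volume := by
  have : IsFiniteMeasure (volume.restrict (unitBall n)) :=
    isFiniteMeasure_restrict.2 volume_unitBall_lt_top.ne
  have hd : Measurable fun x => bdryDist (unitBall n) x ^ r :=
    (continuous_bdryDist (unitBall n)).measurable.pow_const r
  have hmem : MemLp (fun x => bdryDist (unitBall n) x ^ r * u x) q
      (volume.restrict (unitBall n)) := ⟨hd.aestronglyMeasurable.mul hu, hfin⟩
  have hint : IntegrableOn (fun x => bdryDist (unitBall n) x ^ r * u x) (unitBall n) volume :=
    hmem.integrable hq
  have hcont : ContinuousOn (fun x => bdryDist (unitBall n) x ^ (-r)) (unitBall n) :=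
    (continuous_bdryDist (unitBall n)).continuousOn.rpow_const
      fun x hx => Or.inl (bdryDist_pos hn hx).ne'
  refine (hint.locallyIntegrableOn.continuousOn_mul hcont
    isOpen_unitBall.isLocallyClosed).congr ?_
  filter_upwards [ae_restrict_mem measurableSet_unitBall] with x hx
  have := bdryDist_pos hn hx
  rw [← mul_assoc, ← Real.rpow_add this]
  simp

/-- A bound for the Riesz potential on the ball yields the weighted bounds for the Green
potential. -/
theorem exists_weighted_greenPotential_le (hn : 1 ≤ n) (hs : 0 < s) (hs1 : s < 1) {a : ℝ}
    (ha0 : 0 ≤ a) (han : a ≤ n) (ha : (n : ℝ) - 2 * s < a ∨ (2 * s < n ∧ a = n - 2 * s))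
    {p q : ℝ≥0∞} (hq : 1 ≤ q)
    (hT : ∃ C : ℝ, 0 < C ∧ ∀ g : EuclideanSpace ℝ (Fin n) → ℝ≥0∞, Measurable g →
      eLpNorm (fun x => ∫⁻ y in unitBall n, rieszKernel a (x - y) * g y) q
        (volume.restrict (unitBall n)) ≤
          ENNReal.ofReal C * eLpNorm g p (volume.restrict (unitBall n))) :
    ∃ C : ℝ, 0 < C ∧ ∀ r : ℝ, -s ≤ r → r ≤ s →
      ∀ f : EuclideanSpace ℝ (Fin n) → ℝ, MemWeightedLp (unitBall n) r p f →
        GreenPotentialDefined s f ∧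
        MemWeightedLp (unitBall n) r q (greenPotential s f) ∧
        weightedNorm (unitBall n) r q (greenPotential s f) ≤
          ENNReal.ofReal C * weightedNorm (unitBall n) r p f := by
  obtain ⟨C₁, hC₁, hT⟩ := hT
  obtain ⟨C₀, hC₀, hK⟩ := exists_weighted_green_le hn hs hs1 ha0 han ha
  refine ⟨C₀ * C₁, by positivity, fun r hr hr' f hf => ?_⟩
  obtain ⟨hfloc, hfin⟩ := hf
  have : IsFiniteMeasure (volume.restrict (unitBall n)) :=
    isFiniteMeasure_restrict.2 volume_unitBall_lt_top.ne
  have hfm : AEStronglyMeasurable f (volume.restrict (unitBall n)) := hfloc.aestronglyMeasurable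
  have hd : Measurable fun x => bdryDist (unitBall n) x ^ r :=
    (continuous_bdryDist (unitBall n)).measurable.pow_const r
  obtain ⟨g, hgm, hgae⟩ : AEMeasurable (fun y => ‖bdryDist (unitBall n) y ^ r * f y‖ₑ)
      (volume.restrict (unitBall n)) := (hd.aestronglyMeasurable.mul hfm).enorm
  have hgnorm : eLpNorm g p (volume.restrict (unitBall n)) = weightedNorm (unitBall n) r p f := by
    rw [← eLpNorm_congr_ae hgae, eLpNorm_enorm]
    rfl
  have hTle := hT g hgm
  rw [hgnorm] at hTle
  obtain ⟨T, hT'⟩ : ∃ T : EuclideanSpace ℝ (Fin n) → ℝ≥0∞,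
    T = fun x => ∫⁻ y in unitBall n, rieszKernel a (x - y) * g y := ⟨_, rfl⟩
  rw [← hT'] at hTle
  have hTm : Measurable T := by
    rw [hT']
    exact (measurable_rieszKernel_mul a hgm).lintegral_prod_right
  have hTq : eLpNorm T q (volume.restrict (unitBall n)) < ⊤ :=
    hTle.trans_lt (ENNReal.mul_lt_top ENNReal.ofReal_lt_top hfin)
  have hTfin : ∀ᵐ x ∂(volume.restrict (unitBall n)), T x < ⊤ := by
    refine ae_lt_top hTm (ne_of_lt ?_)
    have h1 : eLpNorm T 1 (volume.restrict (unitBall n)) < ⊤ :=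
      (MemLp.mono_exponent (⟨hTm.aestronglyMeasurable, hTq⟩ : MemLp T q _) hq).2
    simpa [eLpNorm_one_eq_lintegral_enorm] using h1
  -- Stated for the integral of absolute values, this yields both convergence where `T` is finite
  -- and the norm bound.
  have hpt : ∀ x ∈ unitBall n, ENNReal.ofReal (bdryDist (unitBall n) x ^ r) *
      ∫⁻ y in unitBall n, ‖f y * green s x y‖ₑ ≤ ENNReal.ofReal C₀ * T x := by
    intro x hx
    rw [← lintegral_const_mul' _ _ ENNReal.ofReal_ne_top, hT',
      ← lintegral_const_mul' _ _ ENNReal.ofReal_ne_top]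
    refine lintegral_mono_ae ?_
    filter_upwards [ae_restrict_mem measurableSet_unitBall, hgae] with y hy hgy
    have hdy := bdryDist_pos hn hy
    have hdx := bdryDist_pos hn hx
    have hG := green_nonneg hn hs hx hy
    rw [← hgy, rieszKernel, Real.enorm_eq_ofReal_abs, Real.enorm_eq_ofReal_abs,
      ← ENNReal.ofReal_mul (by positivity), ← ENNReal.ofReal_mul (by positivity),
      ← ENNReal.ofReal_mul hC₀.le, abs_mul, abs_mul, abs_of_nonneg hG,
      abs_of_pos (Real.rpow_pos_of_pos hdy r)]
    refine ENNReal.ofReal_le_ofReal ?_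
    calc bdryDist (unitBall n) x ^ r * (|f y| * green s x y)
        = bdryDist (unitBall n) x ^ r * green s x y * |f y| := by ring
      _ ≤ C₀ * ‖x - y‖ ^ (-a) * bdryDist (unitBall n) y ^ r * |f y| := by
          exact mul_le_mul_of_nonneg_right (hK r hr hr' x hx y hy) (abs_nonneg _)
      _ = _ := by ring
  have hnorm : weightedNorm (unitBall n) r q (greenPotential s f) ≤
      ENNReal.ofReal (C₀ * C₁) * weightedNorm (unitBall n) r p f := by
    have h1 : ∀ᵐ x ∂(volume.restrict (unitBall n)),
        ‖bdryDist (unitBall n) x ^ r * greenPotential s f x‖ₑ ≤ C₀.toNNReal * ‖T x‖ₑ := by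
      filter_upwards [ae_restrict_mem measurableSet_unitBall] with x hx
      have hdx := bdryDist_pos hn hx
      rw [enorm_mul, Real.enorm_of_nonneg (by positivity), enorm_eq_self]
      simp only [greenPotential, hx, if_true]
      refine le_trans ?_ (hpt x hx)
      gcongr
      exact enorm_integral_le_lintegral_enorm _
    refine (eLpNorm_le_nnreal_smul_eLpNorm_of_ae_le_mul' h1 q).trans ?_
    rw [ENNReal.smul_def, smul_eq_mul, ENNReal.ofReal_mul hC₀.le, mul_assoc]
    exact mul_le_mul_right hTle _
  have hufin : weightedNorm (unitBall n) r q (greenPotential s f) < ⊤ :=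
    hnorm.trans_lt (ENNReal.mul_lt_top ENNReal.ofReal_lt_top hfin)
  have hdef : ∀ x ∈ unitBall n, T x < ⊤ →
      IntegrableOn (fun y => f y * green s x y) (unitBall n) volume := by
    intro x hx hTx
    have hdx := Real.rpow_pos_of_pos (bdryDist_pos hn hx) r
    have hlt := (hpt x hx).trans_lt (ENNReal.mul_lt_top ENNReal.ofReal_lt_top hTx)
    have hlt' : ∫⁻ y in unitBall n, ‖f y * green s x y‖ₑ < ⊤ :=
      ENNReal.lt_top_of_mul_ne_top_right hlt.ne (by simpa using hdx)
    exact ⟨hfm.mul (measurable_green_right x).aestronglyMeasurable, hlt'⟩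
  have hae : GreenPotentialDefined s f := by
    filter_upwards [ae_restrict_mem measurableSet_unitBall, hTfin] with x hx hTx
    exact hdef x hx hTx
  exact ⟨hae, ⟨locallyIntegrableOn_of_weightedNorm_lt_top hn hq
    (aestronglyMeasurable_greenPotential hfm) hufin, hufin⟩, hnorm⟩

end Transfer

/-! ### Riesz potentials on the unit ball -/

section RieszOnBall

variable {n : ℕ}

theorem rieszKernel_rpow {E : Type*} [NormedAddCommGroup E] {a q : ℝ} (hq : 0 ≤ q) (z : E) :
    rieszKernel a z ^ q = rieszKernel (a * q) z := by
  rw [rieszKernel, rieszKernel, ENNReal.ofReal_rpow_of_nonneg (by positivity) hq,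
    ← Real.rpow_mul (norm_nonneg _), neg_mul]

theorem rieszKernel_sub_comm {E : Type*} [NormedAddCommGroup E] (a : ℝ) (x y : E) :
    rieszKernel a (x - y) = rieszKernel a (y - x) := by
  rw [rieszKernel, rieszKernel, norm_sub_rev]

theorem exists_lintegral_unitBall_rieszKernel_rpow_le (hn : 1 ≤ n) {a q : ℝ} (hq : 0 ≤ q)
    (haq : a * q < n) :
    ∃ A : ℝ, 0 < A ∧ ∀ x ∈ unitBall n,
      ∫⁻ y in unitBall n, rieszKernel a (x - y) ^ q ≤ ENNReal.ofReal A := by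
  have : Nonempty (Fin n) := ⟨⟨0, hn⟩⟩
  obtain ⟨C, hC, hCR⟩ := exists_lintegral_near_le (E := EuclideanSpace ℝ (Fin n)) (l := a * q)
    volume (by simpa using haq)
  -- For `x` in the ball, every `x - y` lies in the ball of radius `2`, so the bound is uniform in
  -- `x`.
  refine ⟨_, by positivity, fun x hx => le_trans ?_ (hCR 2 two_pos)⟩
  rw [← lintegral_indicator_sub volume _ measurableSet_ball x,
    ← lintegral_indicator measurableSet_unitBall]
  refine lintegral_mono fun y => ?_
  by_cases hy : y ∈ unitBall n
  · have hxy : x - y ∈ ball (0 : EuclideanSpace ℝ (Fin n)) 2 := by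
      simpa using norm_sub_lt_two hx hy
    rw [indicator_of_mem hy, indicator_of_mem hxy, rieszKernel_rpow hq]
  · rw [indicator_of_notMem hy]
    exact zero_le

/-- A Riesz kernel whose `q`-th power is integrable maps `L¹` of the ball to `L^q`. -/
theorem exists_eLpNorm_riesz_unitBall_le_one (hn : 1 ≤ n) {a q : ℝ} (hq : 1 ≤ q)
    (haq : a * q < n) :
    ∃ C : ℝ, 0 < C ∧ ∀ g : EuclideanSpace ℝ (Fin n) → ℝ≥0∞, Measurable g →
      eLpNorm (fun x => ∫⁻ y in unitBall n, rieszKernel a (x - y) * g y) (ENNReal.ofReal q)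
        (volume.restrict (unitBall n)) ≤
          ENNReal.ofReal C * eLpNorm g 1 (volume.restrict (unitBall n)) := by
  have hq0 : 0 < q := by linarith
  obtain ⟨A, hA, hAx⟩ := exists_lintegral_unitBall_rieszKernel_rpow_le hn hq0.le haq
  refine ⟨A ^ (1 / q), by positivity, fun g hg => ?_⟩
  set μ : Measure (EuclideanSpace ℝ (Fin n)) := volume.restrict (unitBall n) with hμ
  have hG : eLpNorm g 1 μ = ∫⁻ y, g y ∂μ := by simp [eLpNorm_one_eq_lintegral_enorm]
  set G : ℝ≥0∞ := ∫⁻ y, g y ∂μ with hG'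
  have hkx : ∀ x : EuclideanSpace ℝ (Fin n), Measurable fun y => rieszKernel a (x - y) :=
    fun x => (measurable_rieszKernel a).comp (by fun_prop)
  -- Jensen for the measure `g μ` of total mass `G`, as a comparison of its `L¹` and `L^q` norms.
  have hpt : ∀ x, (∫⁻ y, rieszKernel a (x - y) * g y ∂μ) ^ q ≤
      G ^ (q - 1) * ∫⁻ y, rieszKernel a (x - y) ^ q * g y ∂μ := by
    intro x
    have h1 := eLpNorm_le_eLpNorm_mul_rpow_measure_univ (μ := μ.withDensity g)
      (p := ENNReal.ofReal 1) (q := ENNReal.ofReal q) (ENNReal.ofReal_le_ofReal hq)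
      (hkx x).aestronglyMeasurable
    rw [eLpNorm_ofReal one_pos, eLpNorm_ofReal hq0,
      lintegral_withDensity_eq_lintegral_mul _ hg ((hkx x).pow_const _),
      lintegral_withDensity_eq_lintegral_mul _ hg ((hkx x).pow_const _),
      withDensity_apply _ MeasurableSet.univ, Measure.restrict_univ, ← hG',
      ENNReal.toReal_ofReal zero_le_one, ENNReal.toReal_ofReal hq0.le] at h1
    simp only [Pi.mul_apply, ENNReal.rpow_one, div_one] at h1
    have h2 := ENNReal.rpow_le_rpow h1 hq0.le
    rw [ENNReal.mul_rpow_of_nonneg _ _ hq0.le, ← ENNReal.rpow_mul, ← ENNReal.rpow_mul,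
      one_div_mul_cancel hq0.ne', ENNReal.rpow_one, sub_mul, one_div_mul_cancel hq0.ne',
      one_mul] at h2
    simp_rw [mul_comm (g _)] at h2
    rwa [mul_comm (G ^ (q - 1))]
  have hmeas : Measurable (Function.uncurry fun x y : EuclideanSpace ℝ (Fin n) =>
      rieszKernel a (x - y) ^ q * g y) := by
    simp_rw [rieszKernel_rpow hq0.le]
    exact measurable_rieszKernel_mul (a * q) hg
  have hdouble : ∫⁻ x, ∫⁻ y, rieszKernel a (x - y) ^ q * g y ∂μ ∂μ ≤ ENNReal.ofReal A * G := by
    rw [lintegral_lintegral_swap hmeas.aemeasurable, ← lintegral_const_mul _ hg]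
    refine lintegral_mono_ae ?_
    filter_upwards [ae_restrict_mem measurableSet_unitBall] with y hy
    simp_rw [rieszKernel_sub_comm a _ y]
    rw [lintegral_mul_const _ ((hkx y).pow_const q)]
    gcongr
    exact hAx y hy
  have hpow : ∫⁻ x, (∫⁻ y, rieszKernel a (x - y) * g y ∂μ) ^ q ∂μ ≤ ENNReal.ofReal A * G ^ q := by
    calc _ ≤ ∫⁻ x, G ^ (q - 1) * ∫⁻ y, rieszKernel a (x - y) ^ q * g y ∂μ ∂μ :=
          lintegral_mono hpt
      _ = G ^ (q - 1) * ∫⁻ x, ∫⁻ y, rieszKernel a (x - y) ^ q * g y ∂μ ∂μ :=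
          lintegral_const_mul _ hmeas.lintegral_prod_right
      _ ≤ G ^ (q - 1) * (ENNReal.ofReal A * G) := by gcongr
      _ = ENNReal.ofReal A * (G ^ (q - 1) * G ^ (1 : ℝ)) := by rw [ENNReal.rpow_one]; ring
      _ = _ := by
          rw [← ENNReal.rpow_add_of_nonneg _ _ (by linarith) zero_le_one, sub_add_cancel]
  rw [eLpNorm_ofReal hq0, hG]
  calc _ ≤ (ENNReal.ofReal A * G ^ q) ^ (1 / q) := by gcongr
    _ = _ := by
      rw [ENNReal.mul_rpow_of_nonneg _ _ (by positivity), ← ENNReal.rpow_mul,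
        mul_one_div_cancel hq0.ne', ENNReal.rpow_one, ENNReal.ofReal_rpow_of_pos hA]

/-- A Riesz kernel whose conjugate power is integrable maps `L^p` of the ball to `L^∞`. -/
theorem exists_eLpNorm_top_riesz_unitBall_le (hn : 1 ≤ n) {a p q : ℝ}
    (hpq : q.HolderConjugate p) (haq : a * q < n) :
    ∃ C : ℝ, 0 < C ∧ ∀ g : EuclideanSpace ℝ (Fin n) → ℝ≥0∞, Measurable g →
      eLpNorm (fun x => ∫⁻ y in unitBall n, rieszKernel a (x - y) * g y) ⊤
        (volume.restrict (unitBall n)) ≤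
          ENNReal.ofReal C * eLpNorm g (ENNReal.ofReal p) (volume.restrict (unitBall n)) := by
  obtain ⟨A, hA, hAx⟩ := exists_lintegral_unitBall_rieszKernel_rpow_le hn hpq.nonneg haq
  have hq0 := hpq.pos
  refine ⟨A ^ (1 / q), by positivity, fun g hg => ?_⟩
  rw [eLpNorm_exponent_top, eLpNorm_ofReal hpq.symm.pos]
  refine eLpNormEssSup_le_of_ae_enorm_bound ?_
  filter_upwards [ae_restrict_mem measurableSet_unitBall] with x hx
  have hk : Measurable fun y : EuclideanSpace ℝ (Fin n) => rieszKernel a (x - y) :=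
    (measurable_rieszKernel a).comp (by fun_prop)
  rw [enorm_eq_self]
  refine (ENNReal.lintegral_mul_le_Lp_mul_Lq _ hpq hk.aemeasurable hg.aemeasurable).trans ?_
  rw [← ENNReal.ofReal_rpow_of_pos hA]
  gcongr
  exact hAx x hx

/-- The kernel with `a = 0` is identically `1`. This covers `p = 1 > n/(2s)`, where the conjugate
exponent is infinite. -/
theorem exists_eLpNorm_top_riesz_zero_le :
    ∃ C : ℝ, 0 < C ∧ ∀ g : EuclideanSpace ℝ (Fin n) → ℝ≥0∞, Measurable g →
      eLpNorm (fun x => ∫⁻ y in unitBall n, rieszKernel 0 (x - y) * g y) ⊤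
        (volume.restrict (unitBall n)) ≤
          ENNReal.ofReal C * eLpNorm g (ENNReal.ofReal 1) (volume.restrict (unitBall n)) := by
  refine ⟨1, one_pos, fun g _ => ?_⟩
  rw [eLpNorm_exponent_top, eLpNorm_ofReal one_pos]
  refine eLpNormEssSup_le_of_ae_enorm_bound (Filter.Eventually.of_forall fun x => ?_)
  simp [rieszKernel]

theorem exists_eLpNorm_riesz_unitBall_le (hn : 1 ≤ n) {a p q : ℝ} (ha : 0 < a) (hp : 1 < p)
    (hq : 0 < q) (hpq : (n : ℝ) / p - a = n / q) :
    ∃ C : ℝ, 0 < C ∧ ∀ g : EuclideanSpace ℝ (Fin n) → ℝ≥0∞, Measurable g →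
      eLpNorm (fun x => ∫⁻ y in unitBall n, rieszKernel (n - a) (x - y) * g y) (ENNReal.ofReal q)
        (volume.restrict (unitBall n)) ≤
          ENNReal.ofReal C * eLpNorm g (ENNReal.ofReal p) (volume.restrict (unitBall n)) := by
  have : Nonempty (Fin n) := ⟨⟨0, hn⟩⟩
  obtain ⟨C, hC, hCg⟩ := exists_eLpNorm_riesz_le (E := EuclideanSpace ℝ (Fin n)) volume ha hp hq
    (by simpa using hpq)
  refine ⟨C, hC, fun g hg => ?_⟩
  have h1 := hCg _ (hg.indicator measurableSet_unitBall)
  rw [finrank_euclideanSpace_fin, eLpNorm_indicator_eq_eLpNorm_restrict measurableSet_unitBall]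
    at h1
  refine le_trans ((eLpNorm_mono_measure _ Measure.restrict_le_self).trans (le_of_eq ?_)) h1
  congr 1
  funext x
  rw [← lintegral_indicator measurableSet_unitBall]
  refine lintegral_congr fun y => ?_
  by_cases hy : y ∈ unitBall n <;> simp [hy]

/-- The hypothesis leaves room between `max 0 (n - 2s)` and `n/q`. Taking `a` strictly above `n -
2s` treats all signs of `n - 2s` alike, including the logarithmic case `n = 2s`. -/
theorem exists_riesz_exponent (hn : 1 ≤ n) {s q : ℝ} (hq : 1 ≤ q)
    (hqn : q * ((n : ℝ) - 2 * s) < n) :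
    ∃ a : ℝ, 0 ≤ a ∧ a ≤ n ∧ (n : ℝ) - 2 * s < a ∧ a * q < n := by
  have hq0 : 0 < q := by linarith
  have hn0 : (0 : ℝ) < n := by exact_mod_cast hn
  have h1 : max 0 ((n : ℝ) - 2 * s) < n / q := by
    refine max_lt (by positivity) ?_
    rw [lt_div_iff₀ hq0]
    linarith
  have h2 : (n : ℝ) / q ≤ n := div_le_self hn0.le hq
  obtain ⟨a, ha, ha'⟩ := exists_between h1
  rw [max_lt_iff] at ha
  exact ⟨a, ha.1.le, by linarith, ha.2, (lt_div_iff₀ hq0).1 ha'⟩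

end RieszOnBall

end FracLap

theorem mainTheorem3 (n : ℕ) (hn : 1 ≤ n) (s : ℝ) (hs0 : 0 < s) (hs1 : s < 1) :
    -- p = 1
    (∀ q : ℝ, 1 ≤ q → q * ((n : ℝ) - 2 * s) < n →
      ∃ C : ℝ, 0 < C ∧ ∀ r : ℝ, -s ≤ r → r ≤ s →
        ∀ f : EuclideanSpace ℝ (Fin n) → ℝ,
          FracLap.MemWeightedLp (FracLap.unitBall n) r 1 f →
          FracLap.GreenPotentialDefined s f ∧
          FracLap.MemWeightedLp (FracLap.unitBall n) r (ENNReal.ofReal q)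
            (FracLap.greenPotential s f) ∧
          FracLap.weightedNorm (FracLap.unitBall n) r (ENNReal.ofReal q)
              (FracLap.greenPotential s f) ≤
            ENNReal.ofReal C * FracLap.weightedNorm (FracLap.unitBall n) r 1 f) ∧
    -- 1 < p < n / (2s)
    (∀ p : ℝ, 1 < p → p < (n : ℝ) / (2 * s) →
      ∃ C : ℝ, 0 < C ∧ ∀ r : ℝ, -s ≤ r → r ≤ s →
        ∀ f : EuclideanSpace ℝ (Fin n) → ℝ,
          FracLap.MemWeightedLp (FracLap.unitBall n) r (ENNReal.ofReal p) f →
          FracLap.GreenPotentialDefined s f ∧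
          FracLap.MemWeightedLp (FracLap.unitBall n) r
            (ENNReal.ofReal ((n : ℝ) * p / ((n : ℝ) - 2 * s * p)))
            (FracLap.greenPotential s f) ∧
          FracLap.weightedNorm (FracLap.unitBall n) r
              (ENNReal.ofReal ((n : ℝ) * p / ((n : ℝ) - 2 * s * p)))
              (FracLap.greenPotential s f) ≤
            ENNReal.ofReal C *
              FracLap.weightedNorm (FracLap.unitBall n) r (ENNReal.ofReal p) f) ∧
    -- p > n / (2s)
    (∀ p : ℝ, 1 ≤ p → (n : ℝ) / (2 * s) < p →
      ∃ C : ℝ, 0 < C ∧ ∀ r : ℝ, -s ≤ r → r ≤ s →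
        ∀ f : EuclideanSpace ℝ (Fin n) → ℝ,
          FracLap.MemWeightedLp (FracLap.unitBall n) r (ENNReal.ofReal p) f →
          FracLap.GreenPotentialDefined s f ∧
          FracLap.MemWeightedLp (FracLap.unitBall n) r ⊤ (FracLap.greenPotential s f) ∧
          FracLap.weightedNorm (FracLap.unitBall n) r ⊤ (FracLap.greenPotential s f) ≤
            ENNReal.ofReal C *
              FracLap.weightedNorm (FracLap.unitBall n) r (ENNReal.ofReal p) f) := by
  have hn0 : (0 : ℝ) < n := by exact_mod_cast hn
  refine ⟨fun q hq hqn => ?_, fun p hp hpn => ?_, fun p hp hpn => ?_⟩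
  · obtain ⟨a, ha0, han, hasn, haq⟩ := FracLap.exists_riesz_exponent hn hq hqn
    exact FracLap.exists_weighted_greenPotential_le hn hs0 hs1 ha0 han (Or.inl hasn)
      (by simpa using hq) (FracLap.exists_eLpNorm_riesz_unitBall_le_one hn hq haq)
  · have hsp : 2 * s * p < n := by
      rw [lt_div_iff₀ (by positivity)] at hpn
      linarith
    have hns : 2 * s < n := (lt_mul_of_one_lt_right (by positivity) hp).trans hsp
    have hden : 0 < (n : ℝ) - 2 * s * p := sub_pos.2 hsp
    have hp0 : 0 < p := by linarith
    have hq1 : 1 ≤ (n : ℝ) * p / (n - 2 * s * p) := by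
      rw [le_div_iff₀ hden, one_mul]
      nlinarith [mul_pos hs0 hp0]
    refine FracLap.exists_weighted_greenPotential_le hn hs0 hs1 (a := n - 2 * s) (by linarith)
      (by linarith) (Or.inr ⟨hns, rfl⟩) (by simpa using hq1)
      (FracLap.exists_eLpNorm_riesz_unitBall_le hn (by positivity) hp (by positivity) ?_)
    field_simp
  · rw [div_lt_iff₀ (by positivity)] at hpn
    rcases hp.eq_or_lt with rfl | hp1
    · exact FracLap.exists_weighted_greenPotential_le hn hs0 hs1 le_rfl hn0.le
        (Or.inl (by linarith)) le_top FracLap.exists_eLpNorm_top_riesz_zero_le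
    · have hpq := (Real.HolderConjugate.conjExponent hp1).symm
      have hp1' : 0 < p - 1 := sub_pos.2 hp1
      -- For the conjugate exponent `p'`, the condition `p'(n - 2s) < n` is `n < 2sp`.
      obtain ⟨a, ha0, han, hasn, haq⟩ := FracLap.exists_riesz_exponent hn (s := s) hpq.lt.le (by
        rw [Real.conjExponent, div_mul_eq_mul_div, div_lt_iff₀ hp1']
        linarith)
      exact FracLap.exists_weighted_greenPotential_le hn hs0 hs1 ha0 han (Or.inl hasn)
        le_top (FracLap.exists_eLpNorm_top_riesz_unitBall_le hn hpq haq)
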